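/- Let $K$ be a field, $s\ge 1$, $S=K[t_1,\dots,t_s]$ with the standard grading, and let $\mathbb X$ be a finite subset of the projective space $\mathbb P^{s-1}$ over $K$. Let $I(\mathbb X)\subset S$ be the vanishing ideal of $\mathbb X$, i.e. the ideal generated by the homogeneous polynomials that vanish at all points of $\mathbb X$. For a monomial order $\prec$ on $S$, let ${\rm in}_\prec(I(\mathbb X))$ be the initial ideal, generated by the leading monomials of the nonzero elements of $I(\mathbb X)$. An ideal is called a complete intersection if it can be generated by $r$ elements, where $r$ is its height. The Hilbert function of $S/I$ is $H_I(n)=\dim_K (S_n/(I\cap S_n))$, and the regularity ${\rm reg}(S/I)$ is the least integer $r\ge 0$ such that $H_I(n)=h_I(n)$ for all integers $n\ge r$, where $h_I$ is the Hilbert polynomial of $S/I$. Suppose that $\prec$ is a monomial order such that ${\rm in}_\prec(I(\mathbb X))$ is a complete intersection generated by monomials $t^{\alpha_2},\dots,t^{\alpha_s}$, with $d_i=\deg(t^{\alpha_i})$ and $1\le d_2\le\cdots\le d_s$. If hyperplanes $H_1,\dots,H_d$ in $\mathbb P^{s-1}$ avoid a point $[P]\in\mathbb X$ but cover all the other $|\mathbb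 X|-1$ points of $\mathbb X$, then $$d\ \ge\ {\rm reg}(S/I(\mathbb X))=\sum_{i=2}^s(d_i-1).$$ -/

import Mathlib

open MvPolynomial
open scoped LinearAlgebra.Projectivization

noncomputable section

namespace CoveringByHyperplanes

/-- The homogeneous vanishing ideal `I(X)` of a set `X` of points of the projective space
`ℙ^{s-1}` over `K`: the ideal of `K[t_1, …, t_s]` generated by the homogeneous polynomials that
vanish at all points of `X`. (For a homogeneous polynomial, vanishing at a point does not depend
on the chosen representative, see `eval_eq_zero_iff_of_mk`.) -/
def vanishingIdeal {K : Type*} [Field K] {s : ℕ} (X : Set (ℙ K (Fin s → K))) :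
    Ideal (MvPolynomial (Fin s) K) :=
  Ideal.span {f | (∃ n : ℕ, f.IsHomogeneous n) ∧ ∀ P ∈ X, eval P.rep f = 0}

theorem eval_eq_zero_iff_of_mk {K : Type*} [Field K] {s n : ℕ} {f : MvPolynomial (Fin s) K}
    (hf : f.IsHomogeneous n) (v : Fin s → K) (hv : v ≠ 0) :
    eval (Projectivization.mk K v hv).rep f = 0 ↔ eval v f = 0 := by
  obtain ⟨a, ha⟩ := Projectivization.exists_smul_eq_mk_rep K v hv
  rw [← ha]
  have h : eval (a • v) f = (a : K) ^ n * eval v f := by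
    rw [eval_eq, eval_eq, Finset.mul_sum]
    refine Finset.sum_congr rfl fun e he => ?_
    have hdeg : ∑ i ∈ e.support, e i = n := by
      have := hf (mem_support_iff.1 he)
      have h1 := DFunLike.congr_fun (Finsupp.degree_eq_weight_one (σ := Fin s) (R := ℕ)) e
      exact (Finsupp.degree_apply e).symm.trans (h1.trans this)
    simp only [Pi.smul_apply, Units.smul_def, smul_eq_mul, mul_pow, Finset.prod_mul_distrib,
      Finset.prod_pow_eq_pow_sum, hdeg]
    ring
  rw [h]
  simp

/-- The initial ideal of `I` with respect to a monomial order: the ideal generated by the leading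
monomials of the nonzero elements of `I`. -/
def initialIdeal {K : Type*} [Field K] {s : ℕ} (m : MonomialOrder (Fin s))
    (I : Ideal (MvPolynomial (Fin s) K)) : Ideal (MvPolynomial (Fin s) K) :=
  Ideal.span {g | ∃ f ∈ I, f ≠ 0 ∧ g = monomial (m.degree f) (1 : K)}

/-- An ideal is a complete intersection if it can be generated by as many elements as its
height. -/
def IsCompleteIntersection {R : Type*} [CommRing R] (I : Ideal R) : Prop :=
  ∃ (r : ℕ) (g : Fin r → R), I = Ideal.span (Set.range g) ∧ I.height = r

/-- The Hilbert function `H_I(n) = dim_K (S_n / I_n)`, where `S = K[t_1, …, t_s]` and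
`I_n = I ∩ S_n`. -/
def hilbertFunction {K : Type*} [Field K] {s : ℕ} (I : Ideal (MvPolynomial (Fin s) K))
    (n : ℕ) : ℕ :=
  Module.finrank K (homogeneousSubmodule (Fin s) K n ⧸
    (I.restrictScalars K).submoduleOf (homogeneousSubmodule (Fin s) K n))

/-- `h` is the Hilbert polynomial of `S / I`. -/
def IsHilbertPolynomial {K : Type*} [Field K] {s : ℕ} (I : Ideal (MvPolynomial (Fin s) K))
    (h : Polynomial ℚ) : Prop :=
  ∀ᶠ n : ℕ in Filter.atTop, (hilbertFunction I n : ℚ) = h.eval (n : ℚ)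

/-- `r = reg (S / I)`, the regularity of the Hilbert function of `S / I`: the least integer
`r ≥ 0` such that `H_I(n) = h_I(n)` for all `n ≥ r`, where `h_I` is the Hilbert polynomial. -/
def IsRegularity {K : Type*} [Field K] {s : ℕ} (I : Ideal (MvPolynomial (Fin s) K))
    (r : ℕ) : Prop :=
  ∃ h : Polynomial ℚ, IsHilbertPolynomial I h ∧
    IsLeast {r : ℕ | ∀ n : ℕ, r ≤ n → (hilbertFunction I n : ℚ) = h.eval (n : ℚ)} r

theorem IsHilbertPolynomial.unique {K : Type*} [Field K] {s : ℕ}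
    {I : Ideal (MvPolynomial (Fin s) K)} {h h' : Polynomial ℚ}
    (hh : IsHilbertPolynomial I h) (hh' : IsHilbertPolynomial I h') : h = h' := by
  obtain ⟨N, hN⟩ := Filter.eventually_atTop.1 (hh.and hh')
  refine Polynomial.eq_of_infinite_eval_eq h h' ?_
  refine Set.Infinite.mono (s := (fun n : ℕ => (n : ℚ)) '' Set.Ici N) ?_ ?_
  · rintro _ ⟨n, hn, rfl⟩
    exact (hN n hn).1.symm.trans (hN n hn).2
  · exact (Set.Ici_infinite N).image Nat.cast_injective.injOn

theorem IsRegularity.unique {K : Type*} [Field K] {s : ℕ}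
    {I : Ideal (MvPolynomial (Fin s) K)} {r r' : ℕ}
    (hr : IsRegularity I r) (hr' : IsRegularity I r') : r = r' := by
  obtain ⟨h, hh, hl⟩ := hr
  obtain ⟨h', hh', hl'⟩ := hr'
  obtain rfl := hh.unique hh'
  exact hl.unique hl'

/-- A hyperplane of `ℙ^{s-1}`: the zero set of a nonzero linear form. -/
def IsHyperplane {K : Type*} [Field K] {s : ℕ} (H : Set (ℙ K (Fin s → K))) : Prop :=
  ∃ φ : Module.Dual K (Fin s → K), φ ≠ 0 ∧ H = {P | P.submodule ≤ LinearMap.ker φ}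

end CoveringByHyperplanes

end

noncomputable section

namespace CoveringByHyperplanes

/-! ### Counting monomials outside an ideal of pairwise coprime monomials. -/

section AvoidingExponents

variable {σ ι : Type*} [Fintype σ]

/-- The exponents of degree `n` that are not above any `α i` with `i ∈ T`. -/
def avoidingExponents (α : ι → σ →₀ ℕ) (T : Finset ι) (n : ℕ) : Set (σ →₀ ℕ) :=
  {a | a.degree = n ∧ ∀ i ∈ T, ¬ α i ≤ a}

theorem finite_setOf_degree_eq (n : ℕ) : {a : σ →₀ ℕ | a.degree = n}.Finite := by
  classical
  refine (Set.finite_Iic (Finsupp.equivFunOnFinite.symm fun _ => n)).subset fun a ha i => ?_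
  rw [Set.mem_ofPred_eq] at ha
  simpa [ha] using Finsupp.le_degree i a

theorem finite_avoidingExponents (α : ι → σ →₀ ℕ) (T : Finset ι) (n : ℕ) :
    (avoidingExponents α T n).Finite :=
  (finite_setOf_degree_eq n).subset fun _ ha => ha.1

/-- The exponents that stop avoiding are the multiples of `α i`; coprimality makes translation by `α
i` preserve avoidance of `T`. -/
theorem ncard_avoidingExponents_insert [DecidableEq ι] {α : ι → σ →₀ ℕ} {T : Finset ι} {i : ι}
    (hα : ∀ j ∈ T, ∀ k, α i k = 0 ∨ α j k = 0) (n : ℕ) :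
    (avoidingExponents α T n).ncard = (avoidingExponents α (insert i T) n).ncard +
      if (α i).degree ≤ n then (avoidingExponents α T (n - (α i).degree)).ncard else 0 := by
  have hsplit : avoidingExponents α T n = avoidingExponents α (insert i T) n ∪
      {a ∈ avoidingExponents α T n | α i ≤ a} := by
    ext a
    simp only [avoidingExponents, Finset.forall_mem_insert, Set.mem_union, Set.mem_ofPred_eq]
    tauto
  have hdisj : Disjoint (avoidingExponents α (insert i T) n)
      {a ∈ avoidingExponents α T n | α i ≤ a} := by
    rw [Set.disjoint_left]
    rintro a ⟨-, ha⟩ ⟨-, ha'⟩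
    exact ha i (Finset.mem_insert_self _ _) ha'
  rw [hsplit, Set.ncard_union_eq hdisj (finite_avoidingExponents _ _ _)
    ((finite_avoidingExponents α T n).subset fun _ h => h.1)]
  · congr 1
    split_ifs with h
    · rw [← Set.ncard_image_of_injective (avoidingExponents α T (n - (α i).degree))
        (add_right_injective (α i))]
      congr 1
      ext a
      simp only [Set.mem_image, avoidingExponents, Set.mem_ofPred_eq]
      constructor
      · rintro ⟨⟨had, haT⟩, hle⟩
        refine ⟨a - α i, ⟨?_, fun j hj hle' => haT j hj (hle'.trans tsub_le_self)⟩,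
          add_tsub_cancel_of_le hle⟩
        have := congrArg Finsupp.degree (add_tsub_cancel_of_le hle)
        rw [map_add] at this
        omega
      · rintro ⟨b, ⟨hb, hbT⟩, rfl⟩
        refine ⟨⟨by rw [map_add]; omega, fun j hj hle => hbT j hj fun k => ?_⟩, le_self_add⟩
        have h1 := hle k
        rw [Finsupp.add_apply] at h1
        rcases hα j hj k with h0 | h0 <;> omega
    · rw [Set.ncard_eq_zero ((finite_avoidingExponents α T n).subset fun _ h => h.1)]
      ext a
      simp only [avoidingExponents, Set.mem_ofPred_eq, Set.mem_empty_iff_false, iff_false]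
      rintro ⟨⟨had, -⟩, hle⟩
      exact h (had ▸ Finsupp.degree_mono hle)

/-- The generating series of the number of exponents avoiding `α i` for `i ∈ T`. -/
def avoidingSeries (α : ι → σ →₀ ℕ) (T : Finset ι) : PowerSeries ℤ :=
  PowerSeries.mk fun n => ((avoidingExponents α T n).ncard : ℤ)

theorem avoidingSeries_eq_prod_mul {α : ι → σ →₀ ℕ} (T : Finset ι)
    (hα : ∀ i ∈ T, ∀ j ∈ T, i ≠ j → ∀ k, α i k = 0 ∨ α j k = 0) :
    avoidingSeries α T =
      (∏ i ∈ T, (1 - PowerSeries.X ^ (α i).degree)) * avoidingSeries α ∅ := by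
  classical
  induction T using Finset.induction_on with
  | empty => simp
  | insert i T hi ih =>
    rw [Finset.prod_insert hi, mul_assoc, ← ih fun i hi j hj =>
      hα i (Finset.mem_insert_of_mem hi) j (Finset.mem_insert_of_mem hj)]
    ext n
    rw [sub_mul, one_mul, map_sub, PowerSeries.coeff_X_pow_mul']
    simp only [avoidingSeries, PowerSeries.coeff_mk]
    rw [ncard_avoidingExponents_insert (i := i) (fun j hj =>
      hα i (Finset.mem_insert_self _ _) j (Finset.mem_insert_of_mem hj)
        fun h => hi (h ▸ hj)) n]
    split_ifs <;> simp

/-- The product formula is applied to the variables themselves, which only the monomial 1 avoids. -/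
theorem one_sub_X_pow_mul_avoidingSeries_empty (α : ι → σ →₀ ℕ) :
    (1 - PowerSeries.X) ^ Fintype.card σ * avoidingSeries α ∅ = 1 := by
  classical
  have h := avoidingSeries_eq_prod_mul (α := fun k : σ => Finsupp.single k 1) Finset.univ
    fun i _ j _ hij k => by
      by_cases h : i = k
      · right; simp [← h, hij.symm]
      · left; simp [h]
  simp only [Finsupp.degree_single, pow_one, Finset.prod_const, Finset.card_univ] at h
  have hE : avoidingSeries α ∅ = avoidingSeries (fun k : σ => Finsupp.single k 1) ∅ := by
    simp [avoidingSeries, avoidingExponents]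
  rw [hE, ← h]
  ext n
  simp only [avoidingSeries, PowerSeries.coeff_mk, PowerSeries.coeff_one]
  have hz : ∀ a ∈ avoidingExponents (fun k : σ => Finsupp.single k 1) Finset.univ n, a = 0 := by
    rintro a ⟨-, ha⟩
    ext k
    have := ha k (Finset.mem_univ _)
    rw [Finsupp.single_le_iff] at this
    simpa using this
  split_ifs with hn
  · have : avoidingExponents (fun k : σ => Finsupp.single k 1) Finset.univ n = {0} := by
      refine Set.Subset.antisymm (fun a ha => hz a ha) ?_
      rintro _ rfl
      refine ⟨by simp [hn], fun k _ => ?_⟩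
      rw [Finsupp.single_le_iff]
      simp
    rw [this]
    simp
  · have : avoidingExponents (fun k : σ => Finsupp.single k 1) Finset.univ n = ∅ := by
      refine Set.eq_empty_of_forall_notMem fun a ha => hn ?_
      rw [← ha.1, hz a ha]
      simp
    rw [this]
    simp

open Polynomial in
theorem natDegree_geom_sum_X {d : ℕ} (hd : d ≠ 0) :
    (∑ j ∈ Finset.range d, (Polynomial.X : ℤ[X]) ^ j).natDegree = d - 1 := by
  have h := congrArg natDegree (mul_geom_sum (Polynomial.X : ℤ[X]) d)
  rw [← Polynomial.C_1, (monic_X_sub_C (1 : ℤ)).natDegree_mul' (monic_geom_sum_X hd).ne_zero, natDegree_X_sub_C,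
    natDegree_X_pow_sub_C] at h
  omega

open Polynomial in
/-- The numbers of standard monomials of a monomial complete intersection of dimension one, as
partial sums of the coefficients of a monic polynomial. -/
theorem exists_monic_coeff_eq_sub [Fintype ι] {α : ι → σ →₀ ℕ}
    (hcard : Fintype.card σ = Fintype.card ι + 1) (hpos : ∀ i, 1 ≤ (α i).degree)
    (hα : ∀ i j, i ≠ j → ∀ k, α i k = 0 ∨ α j k = 0) :
    ∃ Q : ℤ[X], Q.Monic ∧ Q.natDegree = ∑ i, ((α i).degree - 1) ∧
      ∀ n, Q.coeff (n + 1) = ((avoidingExponents α Finset.univ (n + 1)).ncard : ℤ) -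
        (avoidingExponents α Finset.univ n).ncard := by
  have hm : ∀ i ∈ Finset.univ, (∑ j ∈ Finset.range (α i).degree, (Polynomial.X : ℤ[X]) ^ j).Monic :=
    fun i _ => monic_geom_sum_X (by have := hpos i; omega)
  refine ⟨∏ i, ∑ j ∈ Finset.range (α i).degree, Polynomial.X ^ j, monic_prod_of_monic _ _ hm, ?_, ?_⟩
  · rw [natDegree_prod_of_monic _ _ hm]
    exact Finset.sum_congr rfl fun i _ => natDegree_geom_sum_X (by have := hpos i; omega)
  · have h : ((∏ i, ∑ j ∈ Finset.range (α i).degree, Polynomial.X ^ j : ℤ[X]) : PowerSeries ℤ) =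
        (1 - PowerSeries.X) * avoidingSeries α Finset.univ := by
      rw [avoidingSeries_eq_prod_mul _ fun i _ j _ => hα i j]
      have h1 : ∀ i, (1 - PowerSeries.X ^ (α i).degree : PowerSeries ℤ) =
          (1 - PowerSeries.X) * ∑ j ∈ Finset.range (α i).degree, PowerSeries.X ^ j :=
        fun i => (mul_neg_geom_sum _ _).symm
      simp only [h1, Finset.prod_mul_distrib, Finset.prod_const, Finset.card_univ]
      have h2 := one_sub_X_pow_mul_avoidingSeries_empty α
      rw [hcard] at h2
      have h3 : ((∏ i, ∑ j ∈ Finset.range (α i).degree, Polynomial.X ^ j : ℤ[X]) : PowerSeries ℤ) =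
          ∏ i, ∑ j ∈ Finset.range (α i).degree, PowerSeries.X ^ j := by
        rw [← coeToPowerSeries.ringHom_apply]
        simp
      rw [h3]
      -- All but one of the factors `1 - X` cancel, since there is one more variable than
      -- generators.
      linear_combination -(∏ i, ∑ j ∈ Finset.range (α i).degree, PowerSeries.X ^ j) * h2
    intro n
    rw [← Polynomial.coeff_coe, h, sub_mul, one_mul, map_sub, PowerSeries.coeff_succ_X_mul]
    simp [avoidingSeries]

end AvoidingExponents

end CoveringByHyperplanes

namespace CoveringByHyperplanes

/-! ### Homogeneity of the vanishing ideal. -/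

section VanishingIdeal

variable {K : Type*} [Field K] {s : ℕ} (X : Set (ℙ K (Fin s → K)))

theorem homogeneousComponent_mem_vanishingIdeal {f : MvPolynomial (Fin s) K}
    (hf : f ∈ vanishingIdeal X) (n : ℕ) : homogeneousComponent n f ∈ vanishingIdeal X := by
  let _ := gradedAlgebra (σ := Fin s) (R := K)
  refine homogeneousComponent_mem_of_mem (Ideal.homogeneous_span _ _ fun g hg => ?_) hf n
  exact hg.1

theorem degree_eq_of_mem_support {f : MvPolynomial (Fin s) K} {n : ℕ} (hf : f.IsHomogeneous n)
    {a : Fin s →₀ ℕ} (ha : a ∈ f.support) : a.degree = n := by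
  by_contra h
  exact mem_support_iff.1 ha (hf.coeff_eq_zero h)

theorem eval_rep_eq_zero_of_mem_vanishingIdeal {X : Set (ℙ K (Fin s → K))}
    {f : MvPolynomial (Fin s) K} (hf : f ∈ vanishingIdeal X)
    {P : ℙ K (Fin s → K)} (hP : P ∈ X) : eval P.rep f = 0 := by
  have : vanishingIdeal X ≤ RingHom.ker (eval P.rep) :=
    Ideal.span_le.2 fun g hg => RingHom.mem_ker.2 (hg.2 P hP)
  exact RingHom.mem_ker.1 (this hf)

theorem mem_vanishingIdeal_iff {X : Set (ℙ K (Fin s → K))} {f : MvPolynomial (Fin s) K} {n : ℕ}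
    (hf : f.IsHomogeneous n) : f ∈ vanishingIdeal X ↔ ∀ P ∈ X, eval P.rep f = 0 :=
  ⟨fun h _ hP => eval_rep_eq_zero_of_mem_vanishingIdeal h hP,
    fun h => Ideal.subset_span ⟨⟨n, hf⟩, h⟩⟩

end VanishingIdeal

/-! ### Initial ideals, normal forms and Macaulay's theorem. -/

section LeadingExponents

variable {K : Type*} [Field K] {s : ℕ} (m : MonomialOrder (Fin s))
  (I : Ideal (MvPolynomial (Fin s) K))

/-- The exponents of the leading monomials of the nonzero elements of `I`. -/
def leadingExponents : Set (Fin s →₀ ℕ) :=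
  {a | ∃ f ∈ I, f ≠ 0 ∧ m.degree f = a}

variable {m I}

theorem mem_leadingExponents_of_le {a b : Fin s →₀ ℕ} (ha : a ∈ leadingExponents m I)
    (hab : a ≤ b) : b ∈ leadingExponents m I := by
  obtain ⟨f, hf, hf0, rfl⟩ := ha
  have h1 : monomial (b - m.degree f) (1 : K) ≠ 0 := by simp
  refine ⟨monomial (b - m.degree f) 1 * f, I.mul_mem_left _ hf, mul_ne_zero h1 hf0, ?_⟩
  classical
  rw [m.degree_mul h1 hf0, m.degree_monomial, if_neg one_ne_zero, tsub_add_cancel_of_le hab]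

theorem initialIdeal_eq_span_image : initialIdeal m I =
    Ideal.span ((fun a => monomial a (1 : K)) '' leadingExponents m I) := by
  unfold initialIdeal
  congr 1
  ext g
  constructor
  · rintro ⟨f, hf, hf0, rfl⟩
    exact ⟨_, ⟨f, hf, hf0, rfl⟩, rfl⟩
  · rintro ⟨_, ⟨f, hf, hf0, rfl⟩, rfl⟩
    exact ⟨f, hf, hf0, rfl⟩

theorem mem_leadingExponents_iff {a : Fin s →₀ ℕ} :
    a ∈ leadingExponents m I ↔ monomial a (1 : K) ∈ initialIdeal m I := by
  rw [initialIdeal_eq_span_image, mem_ideal_span_monomial_image]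
  classical
  simp only [support_monomial, one_ne_zero, if_false, Finset.mem_singleton, forall_eq]
  exact ⟨fun h => ⟨a, h, le_rfl⟩, fun ⟨b, hb, hba⟩ => mem_leadingExponents_of_le hb hba⟩

theorem mem_leadingExponents_iff_exists_le {ι : Type*} {α : ι → Fin s →₀ ℕ}
    (h : initialIdeal m I = Ideal.span (Set.range fun i => monomial (α i) (1 : K)))
    {a : Fin s →₀ ℕ} : a ∈ leadingExponents m I ↔ ∃ i, α i ≤ a := by
  have hr : (Set.range fun i => monomial (α i) (1 : K)) =
      (fun a => monomial a (1 : K)) '' Set.range α := by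
    rw [← Set.range_comp]; rfl
  rw [mem_leadingExponents_iff, h, hr, mem_ideal_span_monomial_image]
  classical
  simp [support_monomial]

/-- The homogeneous component containing the leading term stays in `I` and keeps that term as
leading. -/
theorem exists_isHomogeneous_of_mem_leadingExponents
    (hI : ∀ f ∈ I, ∀ n, homogeneousComponent n f ∈ I) {a : Fin s →₀ ℕ}
    (ha : a ∈ leadingExponents m I) :
    ∃ f ∈ I, f.IsHomogeneous a.degree ∧ f ≠ 0 ∧ m.degree f = a := by
  obtain ⟨f, hf, hf0, rfl⟩ := ha
  have hc : coeff (m.degree f) (homogeneousComponent (m.degree f).degree f) ≠ 0 := by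
    rw [coeff_homogeneousComponent, if_pos rfl]
    exact m.coeff_degree_ne_zero_iff.2 hf0
  have h0 : homogeneousComponent (m.degree f).degree f ≠ 0 := by
    intro h; simp [h] at hc
  refine ⟨_, hI f hf _, homogeneousComponent_isHomogeneous _ _,
    h0, ?_⟩
  apply m.toSyn.injective
  refine le_antisymm (m.le_degree ?_) (m.le_degree (mem_support_iff.2 hc))
  have := m.degree_mem_support h0
  rw [mem_support_iff, coeff_homogeneousComponent] at this
  rw [mem_support_iff]
  intro h
  simp [h] at this

/-- The exponents of degree `n` of the monomials outside the initial ideal. -/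
def standardExponents (m : MonomialOrder (Fin s)) (I : Ideal (MvPolynomial (Fin s) K)) (n : ℕ) :
    Set (Fin s →₀ ℕ) :=
  {a | a.degree = n ∧ a ∉ leadingExponents m I}

theorem finite_standardExponents (n : ℕ) : (standardExponents m I n).Finite :=
  (finite_setOf_degree_eq n).subset fun _ ha => ha.1

theorem eq_zero_of_mem_of_support_subset {f : MvPolynomial (Fin s) K} (hf : f ∈ I)
    (h : ∀ a ∈ f.support, a ∉ leadingExponents m I) : f = 0 := by
  by_contra hf0
  exact h _ (m.degree_mem_support hf0) ⟨f, hf, hf0, rfl⟩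

theorem isHomogeneous_of_mem_restrictSupport {n : ℕ} {f : MvPolynomial (Fin s) K}
    (hf : f ∈ restrictSupport K (standardExponents m I n)) : f.IsHomogeneous n := by
  intro a ha
  have := ((mem_restrictSupport_iff K).1 hf (mem_support_iff.2 ha)).1
  rwa [Finsupp.degree_eq_weight_one] at this

/-- Division by well-founded induction on the monomial order: a leading monomial is replaced by the
tail of a homogeneous element of `I`, so the degree is kept. -/
theorem exists_monomial_sub_mem (hI : ∀ f ∈ I, ∀ n, homogeneousComponent n f ∈ I) {n : ℕ}
    (a : Fin s →₀ ℕ) (ha : a.degree = n) :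
    ∃ g ∈ restrictSupport K (standardExponents m I n), monomial a 1 - g ∈ I := by
  induction h : m.toSyn a using WellFoundedLT.induction generalizing a with
  | ind b ih =>
    subst h
    by_cases hL : a ∈ leadingExponents m I
    · obtain ⟨f, hfI, hfh, hf0, hfa⟩ := exists_isHomogeneous_of_mem_leadingExponents hI hL
      have hc : coeff a f ≠ 0 := by rw [← hfa]; exact m.coeff_degree_ne_zero_iff.2 hf0
      have key : ∀ b ∈ f.support.erase a, ∃ g ∈ restrictSupport K (standardExponents m I n),
          monomial b 1 - g ∈ I := by
        intro b hb
        obtain ⟨hba, hb⟩ := Finset.mem_erase.1 hb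
        refine ih (m.toSyn b) (lt_of_le_of_ne ?_ ?_) b ?_ rfl
        · rw [← hfa]; exact m.le_degree hb
        · exact fun h => hba (m.toSyn.injective h)
        · rw [← ha, degree_eq_of_mem_support hfh hb]
      choose! g hg hgI using key
      refine ⟨-∑ b ∈ f.support.erase a, C ((coeff a f)⁻¹ * coeff b f) * g b, ?_, ?_⟩
      · refine neg_mem (sum_mem fun b hb => ?_)
        rw [C_mul']
        exact Submodule.smul_mem _ _ (hg b hb)
      · have hsum : monomial a 1 + ∑ b ∈ f.support.erase a,
            C ((coeff a f)⁻¹ * coeff b f) * monomial b 1 = C (coeff a f)⁻¹ * f := by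
          have hf := f.as_sum
          rw [← Finset.add_sum_erase _ _ (mem_support_iff.2 hc)] at hf
          generalize coeff a f = c at hf hc ⊢
          conv_rhs => rw [hf, mul_add, Finset.mul_sum]
          simp only [C_mul_monomial, mul_one, inv_mul_cancel₀ hc]
        have h2 : monomial a 1 - -∑ b ∈ f.support.erase a, C ((coeff a f)⁻¹ * coeff b f) * g b =
            C (coeff a f)⁻¹ * f - ∑ b ∈ f.support.erase a,
              C ((coeff a f)⁻¹ * coeff b f) * (monomial b 1 - g b) := by
          rw [← hsum]
          simp only [mul_sub, Finset.sum_sub_distrib]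
          ring
        rw [h2]
        exact sub_mem (I.mul_mem_left _ hfI)
          (sum_mem fun b hb => I.mul_mem_left _ (hgI b hb))
    · exact ⟨monomial a 1, (monomial_mem_restrictSupport K).2 (Or.inl ⟨ha, hL⟩), by simp⟩

theorem exists_normalForm (hI : ∀ f ∈ I, ∀ n, homogeneousComponent n f ∈ I) {n : ℕ}
    {f : MvPolynomial (Fin s) K} (hf : f.IsHomogeneous n) :
    ∃ g ∈ restrictSupport K (standardExponents m I n), f - g ∈ I := by
  have key : ∀ a ∈ f.support, ∃ g ∈ restrictSupport K (standardExponents m I n),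
      monomial a 1 - g ∈ I := fun a ha =>
    exists_monomial_sub_mem hI a (degree_eq_of_mem_support hf ha)
  choose! g hg hgI using key
  refine ⟨∑ a ∈ f.support, C (coeff a f) * g a, sum_mem fun a ha => ?_, ?_⟩
  · rw [C_mul']
    exact Submodule.smul_mem _ _ (hg a ha)
  · have h : f - ∑ a ∈ f.support, C (coeff a f) * g a =
        ∑ a ∈ f.support, C (coeff a f) * (monomial a 1 - g a) := by
      simp only [mul_sub, Finset.sum_sub_distrib, C_mul_monomial, mul_one]
      rw [← f.as_sum]
    rw [h]
    exact sum_mem fun a ha => I.mul_mem_left _ (hgI a ha)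

/-- Macaulay's theorem: the Hilbert function counts standard monomials. -/
theorem hilbertFunction_eq_ncard (hI : ∀ f ∈ I, ∀ n, homogeneousComponent n f ∈ I) (n : ℕ) :
    hilbertFunction I n = (standardExponents m I n).ncard := by
  let W := restrictSupport K (standardExponents m I n)
  have hW : W ≤ homogeneousSubmodule (Fin s) K n := fun f hf =>
    isHomogeneous_of_mem_restrictSupport hf
  let Φ : W →ₗ[K] (homogeneousSubmodule (Fin s) K n ⧸
      (I.restrictScalars K).submoduleOf (homogeneousSubmodule (Fin s) K n)) :=
    (Submodule.mkQ _).comp (Submodule.inclusion hW)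
  have hinj : Function.Injective Φ := by
    rw [injective_iff_map_eq_zero]
    rintro ⟨f, hf⟩ h0
    have h1 : f ∈ I := by
      have := (Submodule.Quotient.mk_eq_zero _).1 h0
      simpa [Submodule.submoduleOf] using this
    have : f = 0 := eq_zero_of_mem_of_support_subset h1 fun a ha =>
      ((mem_restrictSupport_iff K).1 hf ha).2
    exact Subtype.ext this
  have hsurj : Function.Surjective Φ := by
    intro q
    obtain ⟨⟨f, hf⟩, rfl⟩ := Submodule.Quotient.mk_surjective _ q
    obtain ⟨g, hg, hfg⟩ := exists_normalForm (m := m) hI hf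
    refine ⟨⟨g, hg⟩, ?_⟩
    refine (Submodule.Quotient.eq _).2 ?_
    have : g - f ∈ I := by rw [← neg_sub]; exact I.neg_mem hfg
    simpa [Submodule.submoduleOf] using this
  have : Finite (standardExponents m I n) := finite_standardExponents n
  unfold hilbertFunction
  rw [← (LinearEquiv.ofBijective Φ ⟨hinj, hsurj⟩).finrank_eq,
    Module.finrank_eq_nat_card_basis (basisRestrictSupport K (standardExponents m I n)),
    Nat.card_coe_set_eq]

end LeadingExponents

end CoveringByHyperplanes

namespace CoveringByHyperplanes

/-! ### Coprimality of the generators and the socle degree bound. -/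

section Combinatorics

variable {σ ι : Type*} [Fintype σ] [Fintype ι] {α : ι → σ →₀ ℕ}

/-- If two generators share a variable, some s - 2 variables meet every generator. All monomials in
two remaining variables are then avoiding, and there are N + 1 of them in degree N. -/
theorem disjoint_of_ncard_avoidingExponents_le (hcard : Fintype.card σ = Fintype.card ι + 1)
    (hpos : ∀ i, 1 ≤ (α i).degree) {N : ℕ}
    (hN : ∀ n, (avoidingExponents α Finset.univ n).ncard ≤ N) {i j : ι} (hij : i ≠ j) (k : σ) :
    α i k = 0 ∨ α j k = 0 := by
  classical
  by_contra! hk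
  have hne : ∀ i, ∃ k, α i k ≠ 0 := by
    intro i
    by_contra! h
    have h0 : α i = 0 := Finsupp.ext h
    have := hpos i
    simp [h0] at this
  choose w hw using hne
  let v : ι → σ := fun l => if l = i ∨ l = j then k else w l
  have hv : ∀ l, α l (v l) ≠ 0 := by
    intro l
    by_cases h : l = i ∨ l = j
    · simp only [v, if_pos h]
      rcases h with rfl | rfl
      exacts [hk.1, hk.2]
    · simp only [v, if_neg h]
      exact hw l
  -- `v` sends both `i` and `j` to `k`, so dropping `j` loses no value.
  have himg : Finset.univ.image v ⊆ (Finset.univ.erase j).image v := by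
    intro x hx
    obtain ⟨l, -, rfl⟩ := Finset.mem_image.1 hx
    by_cases h : l = j
    · exact Finset.mem_image.2 ⟨i, by simp [hij], by simp [v, h]⟩
    · exact Finset.mem_image.2 ⟨l, by simp [h], rfl⟩
  have hc : 1 < (Finset.univ.image v)ᶜ.card := by
    have h1 := (Finset.card_le_card himg).trans Finset.card_image_le
    rw [Finset.card_erase_of_mem (Finset.mem_univ j), Finset.card_univ] at h1
    have h2 : 0 < Fintype.card ι := Fintype.card_pos_iff.2 ⟨i⟩
    rw [Finset.card_compl, hcard]
    omega
  obtain ⟨x, hx, y, hy, hxy⟩ := Finset.one_lt_card.1 hc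
  let e : ℕ → σ →₀ ℕ := fun p => Finsupp.single x p + Finsupp.single y (N - p)
  have hinj : Function.Injective e := by
    intro p q h
    have := DFunLike.congr_fun h x
    simpa [e, hxy.symm] using this
  have hsub : (Finset.range (N + 1)).image e ⊆
      (finite_avoidingExponents α Finset.univ N).toFinset := by
    intro b hb
    obtain ⟨p, hp, rfl⟩ := Finset.mem_image.1 hb
    rw [Set.Finite.mem_toFinset]
    refine ⟨?_, fun l _ hle => hv l ?_⟩
    · have := Finset.mem_range.1 hp
      simp only [e, map_add, Finsupp.degree_single]
      omega
    · have hx' : x ≠ v l := fun h => by simp [h] at hx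
      have hy' : y ≠ v l := fun h => by simp [h] at hy
      have := hle (v l)
      simpa [e, hx', hy'] using this
  have h1 := Finset.card_le_card hsub
  rw [Finset.card_image_of_injective _ hinj, Finset.card_range,
    ← Set.ncard_eq_toFinset_card _ _] at h1
  have := hN N
  omega

/-- If t^a avoids all generators but t^a t_l does not, the generator responsible exceeds `a` at `l`
only, by exactly one. Distinct `l` thus give distinct generators, and by counting all of them occur.
-/
theorem sum_degree_sub_one_le_degree (hcard : Fintype.card σ = Fintype.card ι + 1)
    (hpos : ∀ i, 1 ≤ (α i).degree) (hα : ∀ i j, i ≠ j → ∀ k, α i k = 0 ∨ α j k = 0)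
    {a : σ →₀ ℕ} (ha : ∀ i, ¬ α i ≤ a)
    (hsocle : ∀ l l', l ≠ l' →
      (∃ i, α i ≤ a + Finsupp.single l 1) ∨ ∃ i, α i ≤ a + Finsupp.single l' 1) :
    ∑ i, ((α i).degree - 1) ≤ a.degree := by
  classical
  let B : Finset σ := {l | ∃ i, α i ≤ a + Finsupp.single l 1}
  have hB : Fintype.card ι ≤ B.card := by
    have h1 : Bᶜ.card ≤ 1 := by
      rw [Finset.card_le_one]
      intro l hl l' hl'
      by_contra hne
      simp only [B, Finset.mem_compl, Finset.mem_filter, Finset.mem_univ, true_and] at hl hl'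
      exact (hsocle l l' hne).elim hl hl'
    rw [Finset.card_compl] at h1
    omega
  have hex : ∀ l ∈ B, ∃ i, α i ≤ a + Finsupp.single l 1 := fun l hl => (Finset.mem_filter.1 hl).2
  have : Nonempty ι ∨ IsEmpty ι := (isEmpty_or_nonempty ι).symm
  rcases this with hι | hι
  swap
  · simp
  choose! c hc using hex
  have hle : ∀ l ∈ B, ∀ k ≠ l, α (c l) k ≤ a k := fun l hl k hk => by
    simpa [hk.symm] using hc l hl k
  have hlt : ∀ l ∈ B, a l < α (c l) l := by
    intro l hl
    by_contra! h
    refine ha (c l) fun k => ?_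
    by_cases hk : k = l
    · exact hk ▸ h
    · exact hle l hl k hk
  have hinj : Set.InjOn c B := by
    intro l hl l' hl' h
    by_contra hne
    have h1 := hlt l hl
    have h2 := hle l' hl' l hne
    rw [h] at h1
    omega
  have hcardB : (B.image c).card = B.card := Finset.card_image_of_injOn hinj
  have himg : B.image c = Finset.univ := by
    refine Finset.eq_univ_of_card _ (le_antisymm (Finset.card_le_univ _) ?_)
    rwa [hcardB]
  have hBι : B.card = Fintype.card ι := by rw [← hcardB, himg, Finset.card_univ]
  -- By coprimality at most one generator contributes to each coordinate.
  have hpt : ∑ i, α i ≤ a + ∑ l ∈ B, Finsupp.single l 1 := by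
    intro k
    have hrhs : (∑ l ∈ B, Finsupp.single l 1 : σ →₀ ℕ) k = if k ∈ B then 1 else 0 := by
      simp [Finsupp.finsetSum_apply, Finsupp.single_apply]
    rw [Finsupp.finsetSum_apply, Finsupp.add_apply, hrhs]
    by_cases h : ∃ j, α j k ≠ 0
    · obtain ⟨j, hj⟩ := h
      rw [Finset.sum_eq_single j (fun i _ hij => (hα i j hij k).resolve_right hj) (by simp)]
      obtain ⟨l, hl, rfl⟩ := Finset.mem_image.1 (himg ▸ Finset.mem_univ j)
      by_cases hk : k = l
      · subst hk
        simpa [hl] using hc k hl k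
      · exact (hle l hl k hk).trans le_self_add
    · push Not at h
      simp [h]
  have hdeg := Finsupp.degree_mono hpt
  simp only [map_add, map_sum, Finsupp.degree_single, Finset.sum_const, smul_eq_mul, mul_one,
    hBι] at hdeg
  have hsum : ∑ i, ((α i).degree - 1) + Fintype.card ι = ∑ i, (α i).degree := by
    rw [← Finset.card_univ, Finset.card_eq_sum_ones, ← Finset.sum_add_distrib]
    exact Finset.sum_congr rfl fun i _ => Nat.sub_add_cancel (hpos i)
  omega

end Combinatorics

/-! ### Evaluation at points, linear forms and regularity. -/

section Points

variable {K : Type*} [Field K] {s : ℕ} {X : Set (ℙ K (Fin s → K))}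
  {m : MonomialOrder (Fin s)}

/-- Evaluation on `X` is injective on the span of the standard monomials of degree `n`: a form in
the kernel lies in the ideal. -/
theorem ncard_standardExponents_le (hX : X.Finite) (n : ℕ) :
    (standardExponents m (vanishingIdeal X) n).ncard ≤ X.ncard := by
  let ev : MvPolynomial (Fin s) K →ₗ[K] (X → K) :=
    LinearMap.pi fun P => (aeval P.1.rep : MvPolynomial (Fin s) K →ₐ[K] K).toLinearMap
  have hev : ∀ f P, ev f P = eval P.1.rep f := fun f P => by simp [ev, aeval_eq_eval]
  let Φ := ev.domRestrict (restrictSupport K (standardExponents m (vanishingIdeal X) n))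
  have hinj : Function.Injective Φ := by
    rw [injective_iff_map_eq_zero]
    rintro ⟨f, hf⟩ h0
    have h1 : f ∈ vanishingIdeal X :=
      (mem_vanishingIdeal_iff (isHomogeneous_of_mem_restrictSupport hf)).2 fun P hP => by
        rw [← hev f ⟨P, hP⟩]
        exact congrFun h0 ⟨P, hP⟩
    exact Subtype.ext (eq_zero_of_mem_of_support_subset h1 fun a ha =>
      ((mem_restrictSupport_iff K).1 hf ha).2)
  have := hX.fintype
  have : Finite (standardExponents m (vanishingIdeal X) n) := finite_standardExponents n
  have h := LinearMap.finrank_le_finrank_of_injective hinj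
  rwa [Module.finrank_eq_nat_card_basis (basisRestrictSupport K _), Nat.card_coe_set_eq,
    Module.finrank_fintype_fun_eq_card, ← Nat.card_eq_fintype_card, Nat.card_coe_set_eq] at h

/-- The linear form with the same values as a linear functional. -/
def linearForm (φ : Module.Dual K (Fin s → K)) : MvPolynomial (Fin s) K :=
  ∑ i, C (φ (Pi.single i 1)) * MvPolynomial.X i

theorem linearForm_isHomogeneous (φ : Module.Dual K (Fin s → K)) :
    (linearForm φ).IsHomogeneous 1 :=
  IsHomogeneous.sum _ _ _ fun _ _ => isHomogeneous_C_mul_X _ _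

theorem eval_linearForm (φ : Module.Dual K (Fin s → K)) (v : Fin s → K) :
    eval v (linearForm φ) = φ v := by
  have h : ∀ i : Fin s, (fun j => if i = j then (1 : K) else 0) = Pi.single i 1 := fun i => by
    ext j
    simp [Pi.single_apply, eq_comm]
  rw [LinearMap.pi_apply_eq_sum_univ φ v]
  simp [linearForm, mul_comm, h]

theorem mem_hyperplane_iff (φ : Module.Dual K (Fin s → K)) (P : ℙ K (Fin s → K)) :
    P.submodule ≤ LinearMap.ker φ ↔ eval P.rep (linearForm φ) = 0 := by
  rw [Projectivization.submodule_eq, Submodule.span_singleton_le_iff_mem, LinearMap.mem_ker,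
    eval_linearForm]

/-- If `g` separates `P` from the rest of `X`, multiplying its leading monomial by one of any two
variables gives a leading monomial of `I(X)`. -/
theorem degree_add_single_mem_leadingExponents {g : MvPolynomial (Fin s) K} {d : ℕ}
    (hg : g.IsHomogeneous d) (hg0 : g ≠ 0) {P : ℙ K (Fin s → K)}
    (hvan : ∀ Q ∈ X, Q ≠ P → eval Q.rep g = 0) {l l' : Fin s} (hl : l ≠ l') :
    m.degree g + Finsupp.single l 1 ∈ leadingExponents m (vanishingIdeal X) ∨
      m.degree g + Finsupp.single l' 1 ∈ leadingExponents m (vanishingIdeal X) := by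
  have key : ∀ q : MvPolynomial (Fin s) K, q.IsHomogeneous 1 → q ≠ 0 → eval P.rep q = 0 →
      m.degree g + m.degree q ∈ leadingExponents m (vanishingIdeal X) := by
    intro q hq hq0 hqP
    refine ⟨g * q, (mem_vanishingIdeal_iff (hg.mul hq)).2 fun Q hQ => ?_, mul_ne_zero hg0 hq0,
      m.degree_mul hg0 hq0⟩
    rw [map_mul]
    by_cases h : Q = P
    · rw [h, hqP, mul_zero]
    · rw [hvan Q hQ h, zero_mul]
  by_cases hp : P.rep l = 0
  · left
    simpa [m.degree_X] using key (MvPolynomial.X l) (isHomogeneous_X _ _) (X_ne_zero _) (by simpa)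
  -- The form in `l`, `l'` vanishing at `P`; it is nonzero because `P.rep l ≠ 0`.
  · let q : MvPolynomial (Fin s) K :=
      C (P.rep l') * MvPolynomial.X l - C (P.rep l) * MvPolynomial.X l'
    have hc : ∀ a, coeff a q = (if Finsupp.single l 1 = a then P.rep l' else 0) -
        if Finsupp.single l' 1 = a then P.rep l else 0 := by
      classical
      intro a
      simp [q, coeff_C_mul, coeff_X]
    have hq0 : q ≠ 0 := by
      intro h
      have h1 := hc (Finsupp.single l' 1)
      rw [if_neg, if_pos rfl, h, coeff_zero] at h1
      · exact hp (by simpa using h1.symm)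
      · exact fun h => hl (Finsupp.single_left_injective one_ne_zero h)
    have h1 := key q ((isHomogeneous_C_mul_X _ _).sub (isHomogeneous_C_mul_X _ _)) hq0
      (by simp [q, mul_comm])
    have h2 := m.degree_mem_support hq0
    rw [mem_support_iff, hc] at h2
    by_cases ha : Finsupp.single l 1 = m.degree q
    · left; rwa [ha]
    · by_cases hb : Finsupp.single l' 1 = m.degree q
      · right; rwa [hb]
      · simp [ha, hb] at h2

/-- Increments vanish beyond the degree of `Q`, and the last one is the leading coefficient 1, so
the Hilbert function becomes constant exactly there. -/
theorem isRegularity_of_sub_eq_coeff {I : Ideal (MvPolynomial (Fin s) K)} {Q : Polynomial ℤ}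
    (hQ : Q.Monic) (h : ∀ n, Q.coeff (n + 1) = (hilbertFunction I (n + 1) : ℤ) -
      hilbertFunction I n) : IsRegularity I Q.natDegree := by
  have hconst : ∀ n, Q.natDegree ≤ n → hilbertFunction I n = hilbertFunction I Q.natDegree := by
    intro n hn
    induction n, hn using Nat.le_induction with
    | base => rfl
    | succ n hn ih =>
      have h1 := h n
      rw [Polynomial.coeff_eq_zero_of_natDegree_lt (by omega)] at h1
      omega
  refine ⟨Polynomial.C (hilbertFunction I Q.natDegree : ℚ), ?_, ?_, ?_⟩
  · filter_upwards [Filter.eventually_ge_atTop Q.natDegree] with n hn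
    rw [Polynomial.eval_C, hconst n hn]
  · intro n hn
    rw [Polynomial.eval_C, hconst n hn]
  · intro r hr
    by_contra! hlt
    obtain ⟨n, hn⟩ : ∃ n, Q.natDegree = n + 1 := ⟨Q.natDegree - 1, by omega⟩
    have h1 := h n
    rw [← hn, hQ.coeff_natDegree] at h1
    have h2 := hr n (by omega)
    rw [Polynomial.eval_C, Nat.cast_inj] at h2
    omega

end Points

end CoveringByHyperplanes

end

/-! ### The main theorem. -/

open CoveringByHyperplanes in
theorem mainTheorem6 {K : Type*} [Field K] {s : ℕ} (X : Set (ℙ K (Fin s → K))) (hX : X.Finite)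
    (m : MonomialOrder (Fin s))
    (hCI : CoveringByHyperplanes.IsCompleteIntersection
      (CoveringByHyperplanes.initialIdeal m (CoveringByHyperplanes.vanishingIdeal X)))
    (α : Fin (s - 1) → (Fin s →₀ ℕ))
    (hgen : CoveringByHyperplanes.initialIdeal m (CoveringByHyperplanes.vanishingIdeal X) =
      Ideal.span (Set.range fun i => MvPolynomial.monomial (α i) (1 : K)))
    (hpos : ∀ i, 1 ≤ (α i).degree)
    (hmono : Monotone fun i => (α i).degree)
    (d : ℕ) (H : Fin d → Set (ℙ K (Fin s → K)))
    (hH : ∀ j, CoveringByHyperplanes.IsHyperplane (H j))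
    (P : ℙ K (Fin s → K)) (hP : P ∈ X)
    (havoid : ∀ j, P ∉ H j)
    (hcover : ∀ Q ∈ X, Q ≠ P → ∃ j, Q ∈ H j) :
    CoveringByHyperplanes.IsRegularity (CoveringByHyperplanes.vanishingIdeal X)
        (∑ i, ((α i).degree - 1)) ∧
      ∑ i, ((α i).degree - 1) ≤ d := by
  have hI : ∀ f ∈ vanishingIdeal X, ∀ n, homogeneousComponent n f ∈ vanishingIdeal X :=
    fun f hf n => homogeneousComponent_mem_vanishingIdeal X hf n
  have hs : s ≠ 0 := by
    rintro rfl
    exact P.rep_nonzero (Subsingleton.elim _ _)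
  have hcard : Fintype.card (Fin s) = Fintype.card (Fin (s - 1)) + 1 := by
    simp only [Fintype.card_fin]
    omega
  have hstd : ∀ n, standardExponents m (vanishingIdeal X) n =
      avoidingExponents α Finset.univ n := by
    intro n
    ext a
    simp [standardExponents, avoidingExponents, mem_leadingExponents_iff_exists_le hgen]
  have hα : ∀ i j, i ≠ j → ∀ k, α i k = 0 ∨ α j k = 0 := fun i j hij k =>
    disjoint_of_ncard_avoidingExponents_le hcard hpos
      (fun n => hstd n ▸ ncard_standardExponents_le hX n) hij k
  constructor
  · obtain ⟨Q, hQ, hQdeg, hQc⟩ := exists_monic_coeff_eq_sub hcard hpos hα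
    rw [← hQdeg]
    refine isRegularity_of_sub_eq_coeff hQ fun n => ?_
    rw [hQc, hilbertFunction_eq_ncard (m := m) hI, hilbertFunction_eq_ncard (m := m) hI, hstd,
      hstd]
  · choose φ _ hφ using hH
    have hmem : ∀ j Q, Q ∈ H j ↔ eval Q.rep (linearForm (φ j)) = 0 := fun j Q => by
      rw [hφ, Set.mem_ofPred_eq, mem_hyperplane_iff]
    have hF : (∏ j, linearForm (φ j)).IsHomogeneous d := by
      simpa using IsHomogeneous.prod Finset.univ (fun j => linearForm (φ j)) (fun _ => 1)
        fun j _ => linearForm_isHomogeneous (φ j)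
    -- Reduction keeps the values on `X` and makes the leading exponent standard.
    obtain ⟨g, hg, hFg⟩ := exists_normalForm (m := m) hI hF
    have hgev : ∀ Q ∈ X, eval Q.rep g = ∏ j, eval Q.rep (linearForm (φ j)) := by
      intro Q hQ
      have := eval_rep_eq_zero_of_mem_vanishingIdeal hFg hQ
      rw [map_sub, map_prod, sub_eq_zero] at this
      exact this.symm
    have hg0 : g ≠ 0 := by
      rintro rfl
      have := hgev P hP
      rw [map_zero] at this
      obtain ⟨j, -, hj⟩ := Finset.prod_eq_zero_iff.1 this.symm
      exact havoid j ((hmem j P).2 hj)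
    have hvan : ∀ Q ∈ X, Q ≠ P → eval Q.rep g = 0 := by
      intro Q hQ hQP
      obtain ⟨j, hj⟩ := hcover Q hQ hQP
      rw [hgev Q hQ]
      exact Finset.prod_eq_zero (Finset.mem_univ j) ((hmem j Q).1 hj)
    obtain ⟨hdeg, hlead⟩ := (mem_restrictSupport_iff K).1 hg (m.degree_mem_support hg0)
    rw [mem_leadingExponents_iff_exists_le hgen, not_exists] at hlead
    rw [← hdeg]
    refine sum_degree_sub_one_le_degree hcard hpos hα hlead fun l l' hl => ?_
    simp only [← mem_leadingExponents_iff_exists_le hgen]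
    exact degree_add_single_mem_leadingExponents (isHomogeneous_of_mem_restrictSupport hg) hg0
      hvan hl
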